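/- Let $G$ be a finitely generated (discrete) group and let $\pi$ be a unitary representation of $G$ on a complex Hilbert space $\mathcal H$. Write $Z^1(G,\pi)=\{b:G\to\mathcal H \mid b(gh)=b(g)+\pi(g)b(h)\ \forall g,h\in G\}$ for the space of cocycles, $B^1(G,\pi)=\{g\mapsto \pi(g)\xi-\xi \mid \xi\in\mathcal H\}$ for the space of coboundaries, and $\overline{H}^1(G,\pi)=Z^1(G,\pi)/\overline{B^1(G,\pi)}$ for the reduced cohomology, the closure being taken for uniform convergence on compact (that is, finite) subsets of $G$. Assume that $\pi$ is ergodic, i.e. every coefficient $x\mapsto\langle\eta,\pi(x)\xi\rangle$ $(\eta,\xi\in\mathcal H)$ has mean $0$ for the unique invariant mean on the space $\mathrm{WAP}(G)$ of weakly almost periodic functions (those bounded $f:G\to\mathbb C$ for which the weak closure in $\ell^\infty G$ of the orbit of $f$ under translation is weakly compact). Assume also that $\overline{H}^1(G,\pi)\neq 0$. Let $\mu$ be a finitely supported symmetric probability measure on $G$ (symmetric: $\mu(s^{-1})=\mu(s)$ for all $s\in G$) such that $G$ is $\mu$-Liouville, i.e. every bounded function $f:G\to\mathbb C$ with $\sum_{s}\mu(s)f(s^{-1}x)=f(x)$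 for all $x\in G$ is constant. Then for every non-zero cocycle $b\in Z^1(G,\pi)$ which is $\mu$-harmonic, i.e. $\sum_{s}\mu(s)b(s)=0$, the centre $Z(G)$ satisfies $$Z(G)\subset \ker b\cap\ker \pi|_{\mathrm{im}\, b},$$ where $\ker b=b^{-1}(0)$ and $\ker \pi|_{\mathrm{im}\, b}$ is the set of $g\in G$ such that $\pi(g)v=v$ for all $v$ in the closed linear span of $b(G)$. -/

import Mathlib

open scoped ENNReal

/-! ### Bounded functions, weakly almost periodic functions and invariant means -/

/-- `ℓ^∞ G`: bounded complex functions on `G` with the supremum norm. -/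
abbrev LInfty (G : Type*) : Type _ := lp (fun _ : G => ℂ) ∞

/-- The bounded function with values `u x`, given a bound. -/
noncomputable def LInfty.ofBound {G : Type*} (u : G → ℂ) (C : ℝ) (h : ∀ x, ‖u x‖ ≤ C) : LInfty G :=
  ⟨u, memℓp_infty ⟨C, by rintro _ ⟨x, rfl⟩; exact h x⟩⟩

/-- The translation action `(γ · f)(x) = f (γ⁻¹ x)` on bounded functions. -/
noncomputable def leftTranslate {G : Type*} [Group G] (γ : G) (f : LInfty G) : LInfty G :=
  LInfty.ofBound (fun x => f (γ⁻¹ * x)) ‖f‖ (fun _ => lp.norm_apply_le_norm (by simp) f _)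

theorem leftTranslate_add {G : Type*} [Group G] (γ : G) (f g : LInfty G) :
    leftTranslate γ (f + g) = leftTranslate γ f + leftTranslate γ g := rfl

theorem leftTranslate_smul {G : Type*} [Group G] (γ : G) (c : ℂ) (f : LInfty G) :
    leftTranslate γ (c • f) = c • leftTranslate γ f := rfl

theorem leftTranslate_mul {G : Type*} [Group G] (γ δ : G) (f : LInfty G) :
    leftTranslate γ (leftTranslate δ f) = leftTranslate (γ * δ) f := by
  ext x
  change f (δ⁻¹ * (γ⁻¹ * x)) = f ((γ * δ)⁻¹ * x)
  rw [mul_inv_rev, mul_assoc]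

/-- The orbit `G · f`, seen in `ℓ^∞ G` with its weak topology. -/
def weakOrbit {G : Type*} [Group G] (f : LInfty G) : Set (WeakSpace ℂ (LInfty G)) :=
  Set.range fun γ : G => toWeakSpace ℂ (LInfty G) (leftTranslate γ f)

/-- The space `WAP(G)` of weakly almost periodic functions: the bounded functions whose orbit
under translation has a weakly compact weak closure. -/
noncomputable def WAP (G : Type*) [Group G] : Submodule ℂ (LInfty G) where
  carrier := {f | IsCompact (closure (weakOrbit f))}
  add_mem' := by
    intro f g hf hg
    refine IsCompact.closure_of_subset (hf.add hg) ?_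
    rintro _ ⟨γ, rfl⟩
    exact Set.mem_add.2 ⟨_, subset_closure ⟨γ, rfl⟩, _, subset_closure ⟨γ, rfl⟩, rfl⟩
  zero_mem' := by
    refine IsCompact.closure_of_subset (isCompact_singleton (x := 0)) ?_
    rintro _ ⟨γ, rfl⟩
    rfl
  smul_mem' := by
    intro c f hf
    refine IsCompact.closure_of_subset (hf.image (continuous_const_smul c)) ?_
    rintro _ ⟨γ, rfl⟩
    exact ⟨_, subset_closure ⟨γ, rfl⟩, rfl⟩

/-- The constant function `1` on `G`, as an element of `WAP(G)`. -/
noncomputable def WAP.one (G : Type*) [Group G] : WAP G :=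
  ⟨LInfty.ofBound (fun _ => 1) 1 (fun _ => by simp), by
    refine IsCompact.closure_of_subset (isCompact_singleton
      (x := toWeakSpace ℂ (LInfty G) (LInfty.ofBound (fun _ => 1) 1 (fun _ => by simp)))) ?_
    rintro _ ⟨γ, rfl⟩
    rfl⟩

/-- Translation of weakly almost periodic functions. -/
noncomputable def WAP.translate {G : Type*} [Group G] (γ : G) (f : WAP G) : WAP G :=
  ⟨leftTranslate γ f.1, by
    refine IsCompact.closure_of_subset f.2 (Set.Subset.trans ?_ subset_closure)
    rintro _ ⟨δ, rfl⟩
    exact ⟨δ * γ, by simp only [leftTranslate_mul]⟩⟩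

open scoped ComplexOrder in
/-- A continuous linear functional on `WAP(G)` is an invariant mean if it is unital, positive and
invariant under translation. Every group carries exactly one invariant mean on `WAP(G)`. -/
structure IsInvariantMean {G : Type*} [Group G] (m : WAP G →L[ℂ] ℂ) : Prop where
  map_one : m (WAP.one G) = 1
  nonneg : ∀ f : WAP G, (∀ x, 0 ≤ f.1 x) → 0 ≤ m f
  invariant : ∀ (γ : G) (f : WAP G), m (WAP.translate γ f) = m f

/-! ### Unitary representations -/

section Rep

variable {G : Type*} [Group G] {H : Type*} [NormedAddCommGroup H] [InnerProductSpace ℂ H]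

/-- The coefficient `κ_{η,ξ}(x) = ⟨η | π(x) ξ⟩` as a bounded function on `G`. -/
noncomputable def coeffFun (π : G →* (H ≃ₗᵢ[ℂ] H)) (η ξ : H) : LInfty G :=
  LInfty.ofBound (fun x => inner ℂ η (π x ξ)) (‖η‖ * ‖ξ‖) (fun x => by
    simpa using norm_inner_le_norm (𝕜 := ℂ) η (π x ξ))

/-- Auxiliary map `φ ↦ (x ↦ φ (π x ξ))` from the dual of `H` to `ℓ^∞ G`. -/
noncomputable def dualCoeff (π : G →* (H ≃ₗᵢ[ℂ] H)) (ξ : H) : (H →L[ℂ] ℂ) →L[ℂ] LInfty G :=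
  LinearMap.mkContinuous
    { toFun := fun φ => LInfty.ofBound (fun x => φ (π x ξ)) (‖φ‖ * ‖ξ‖) (fun x => by
        simpa using φ.le_opNorm (π x ξ))
      map_add' := fun _ _ => rfl
      map_smul' := fun _ _ => rfl }
    ‖ξ‖ (fun φ => by
      refine lp.norm_le_of_forall_le (by positivity) (fun x => ?_)
      have := φ.le_opNorm (π x ξ)
      rw [LinearIsometryEquiv.norm_map, mul_comm] at this
      exact this)

/-- Coefficients of unitary representations are weakly almost periodic. -/
theorem coeffFun_mem_WAP [CompleteSpace H] (π : G →* (H ≃ₗᵢ[ℂ] H)) (η ξ : H) :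
    coeffFun π η ξ ∈ WAP G := by
  have hcont : Continuous fun φ : WeakDual ℂ H =>
      toWeakSpace ℂ (LInfty G) (dualCoeff π ξ (WeakDual.toStrongDual φ)) := by
    refine WeakBilin.continuous_of_continuous_eval _ fun ψ => ?_
    let Ψ : (H →L[ℂ] ℂ) →L[ℂ] ℂ := ContinuousLinearMap.comp ψ (dualCoeff π ξ)
    obtain ⟨v, hv⟩ : ∃ v : H, ∀ φ : H →L[ℂ] ℂ, Ψ φ = φ v := by
      let χ : H →L[ℂ] ℂ := LinearMap.mkContinuous
        { toFun := fun u => starRingEnd ℂ (Ψ (innerSL ℂ u))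
          map_add' := fun u w => by simp only [map_add]
          map_smul' := fun c u => by
            simp only [map_smulₛₗ, smul_eq_mul, map_mul, RingHom.id_apply, Complex.conj_conj] }
        ‖Ψ‖ (fun u => by
          have := Ψ.le_opNorm (innerSL ℂ u)
          rw [innerSL_apply_norm] at this
          simpa using this)
      refine ⟨(InnerProductSpace.toDual ℂ H).symm χ, fun φ => ?_⟩
      obtain ⟨u, rfl⟩ := (InnerProductSpace.toDual ℂ H).surjective φ
      have h1 : inner ℂ ((InnerProductSpace.toDual ℂ H).symm χ) u = χ u :=
        InnerProductSpace.toDual_symm_apply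
      rw [InnerProductSpace.toDual_apply_apply, ← inner_conj_symm, h1]
      exact (Complex.conj_conj _).symm
    have : (fun φ : WeakDual ℂ H => φ v) = fun φ : WeakDual ℂ H =>
        Ψ (WeakDual.toStrongDual φ) := by
      funext φ
      exact (hv _).symm
    have h2 : Continuous fun φ : WeakDual ℂ H => φ v := WeakDual.eval_continuous v
    rw [this] at h2
    exact h2
  have hK := (WeakDual.isCompact_closedBall (𝕜 := ℂ) (E := H) 0 ‖η‖).image hcont
  refine IsCompact.closure_of_subset hK ?_
  rintro _ ⟨γ, rfl⟩
  refine ⟨StrongDual.toWeakDual (innerSL ℂ (π γ η)), by simp, ?_⟩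
  refine congrArg (toWeakSpace ℂ (LInfty G)) ?_
  refine lp.ext (funext fun x => ?_)
  change inner ℂ (π γ η) (π x ξ) = inner ℂ η (π (γ⁻¹ * x) ξ)
  rw [← (π γ).inner_map_map η, map_mul, map_inv]
  congr 1
  change _ = (π γ * ((π γ)⁻¹ * π x)) ξ
  rw [mul_inv_cancel_left]

/-- The coefficient `κ_{η,ξ}` as an element of `WAP(G)`. -/
noncomputable def coeff [CompleteSpace H] (π : G →* (H ≃ₗᵢ[ℂ] H)) (η ξ : H) : WAP G :=
  ⟨coeffFun π η ξ, coeffFun_mem_WAP π η ξ⟩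

/-- A unitary representation is ergodic if all its coefficients have mean `0` for the (unique)
invariant mean on `WAP(G)`. -/
def IsErgodicRep [CompleteSpace H] (π : G →* (H ≃ₗᵢ[ℂ] H)) : Prop :=
  ∃ m : WAP G →L[ℂ] ℂ, IsInvariantMean m ∧ ∀ η ξ : H, m (coeff π η ξ) = 0

/-! ### Cocycles and reduced cohomology -/

/-- The space `Z¹(G,π)` of cocycles: maps with `b(gh) = b(g) + π(g) b(h)`. -/
def Z1 (π : G →* (H ≃ₗᵢ[ℂ] H)) : Submodule ℂ (G → H) where
  carrier := {b | ∀ g h, b (g * h) = b g + π g (b h)}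
  add_mem' := by
    intro a b ha hb g h
    simp only [Pi.add_apply, ha g h, hb g h, map_add]
    abel
  zero_mem' := by
    intro g h
    simp
  smul_mem' := by
    intro c b hb g h
    simp only [Pi.smul_apply, hb g h, map_smul, smul_add]

/-- The coboundary map `d : H → Z¹(G,π)`, `(d ξ)(g) = π(g) ξ - ξ`. -/
noncomputable def coboundaryMap (π : G →* (H ≃ₗᵢ[ℂ] H)) : H →ₗ[ℂ] Z1 π where
  toFun ξ := ⟨fun g => π g ξ - ξ, fun g h => by
    simp only [map_mul, LinearIsometryEquiv.coe_mul, Function.comp_apply, map_sub]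
    abel⟩
  map_add' ξ ζ := by
    ext g
    simp only [map_add, Submodule.coe_add, Pi.add_apply]
    abel
  map_smul' c ξ := by
    ext g
    simp only [map_smul, RingHom.id_apply, Submodule.coe_smul, Pi.smul_apply, smul_sub]

/-- The space `B¹(G,π)` of coboundaries. -/
noncomputable def B1 (π : G →* (H ≃ₗᵢ[ℂ] H)) : Submodule ℂ (Z1 π) := LinearMap.range (coboundaryMap π)

/-- The closure of `B¹(G,π)` in `Z¹(G,π)` for uniform convergence on compact subsets of the
discrete group `G`. Those are the finite subsets, so this is the topology of `G → H`. -/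
noncomputable def B1Closure (π : G →* (H ≃ₗᵢ[ℂ] H)) : Submodule ℂ (Z1 π) := (B1 π).topologicalClosure

/-- The reduced cohomology of `π` in degree one. -/
abbrev ReducedH1 (π : G →* (H ≃ₗᵢ[ℂ] H)) : Type _ := Z1 π ⧸ B1Closure π

/-- The kernel `b⁻¹(0)` of a cocycle, a subgroup of `G`. -/
def cocycleKer {π : G →* (H ≃ₗᵢ[ℂ] H)} (b : Z1 π) : Subgroup G where
  carrier := {g | b.1 g = 0}
  mul_mem' := by
    intro g h hg hh
    change b.1 (g * h) = 0
    change b.1 g = 0 at hg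
    change b.1 h = 0 at hh
    rw [b.2 g h, hg, hh, map_zero, add_zero]
  one_mem' := by
    have h := b.2 1 1
    simpa using h
  inv_mem' := by
    intro g hg
    change b.1 g = 0 at hg
    have h1 := b.2 1 1
    have h := b.2 g g⁻¹
    rw [mul_inv_cancel, hg, zero_add] at h
    have h2 : b.1 1 = 0 := by simpa using h1
    rw [h2] at h
    exact (π g).map_eq_zero_iff.1 h.symm

/-- The subrepresentation spanned by a cocycle: the closed linear span of its values. -/
def cocycleImage {π : G →* (H ≃ₗᵢ[ℂ] H)} (b : Z1 π) : Submodule ℂ H :=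
  (Submodule.span ℂ (Set.range b.1)).topologicalClosure

/-- The kernel of `π` restricted to `V`: the elements that act trivially on `V`. -/
def repKerOn (π : G →* (H ≃ₗᵢ[ℂ] H)) (V : Submodule ℂ H) : Subgroup G where
  carrier := {g | ∀ v ∈ V, π g v = v}
  mul_mem' := by
    intro g h hg hh v hv
    rw [map_mul, LinearIsometryEquiv.coe_mul, Function.comp_apply, hh v hv, hg v hv]
  one_mem' := by
    intro v _
    simp
  inv_mem' := by
    intro g hg v hv
    have h : (π g⁻¹ * π g) v = v := by rw [← map_mul, inv_mul_cancel, map_one]; rfl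
    rw [LinearIsometryEquiv.coe_mul, Function.comp_apply, hg v hv] at h
    exact h

/-! ### Harmonicity -/

/-- `μ` is a symmetric probability measure (of finite support) on `G`. -/
structure IsSymmProbability (μ : G →₀ ℝ) : Prop where
  nonneg : ∀ g, 0 ≤ μ g
  total : ∑ s ∈ μ.support, μ s = 1
  symm : ∀ g, μ g⁻¹ = μ g

/-- `G` is `μ`-Liouville: every bounded `μ`-harmonic function on `G` is constant. -/
def IsLiouvilleGroup (μ : G →₀ ℝ) : Prop :=
  ∀ f : LInfty G, (∀ x, ∑ s ∈ μ.support, (μ s : ℂ) * f (s⁻¹ * x) = f x) →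
    ∃ c : ℂ, ∀ x, f x = c

/-- A cocycle `b` is `μ`-harmonic if `∑ μ(s) b(s) = 0`. -/
def IsHarmonicCocycle {π : G →* (H ≃ₗᵢ[ℂ] H)} (μ : G →₀ ℝ) (b : Z1 π) : Prop :=
  ∑ s ∈ μ.support, (μ s : ℂ) • b.1 s = 0

end Rep

/-! For central `z`, the two expansions of `b(zg) = b(gz)` give `π(g)b(z) - b(z) = π(z)b(g) - b(g)`
(`Z1.sub_eq_of_mem_center`). Averaging over `g` against `μ` kills the right side, since `b` is
harmonic and `π(z)` is linear; so `b(z)` is fixed by the operator `∑ μ(s) π(s)`. The Liouville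
property turns this into invariance under all of `G` (`IsLiouvilleGroup.fixed_of_average_fixed`),
and ergodicity leaves no nonzero invariant vector, so `b(z) = 0`. The same identity then says that
`π(z)` fixes every `b(g)`, hence by linearity and continuity their closed linear span. -/

/-- The only vector fixed by an ergodic representation is `0`: the coefficient of a fixed vector
`v` is the constant `⟨v, v⟩`, whose mean is `⟨v, v⟩`. -/
theorem IsErgodicRep.eq_zero_of_forall_fixed {G : Type*} [Group G]
    {H : Type*} [NormedAddCommGroup H] [InnerProductSpace ℂ H] [CompleteSpace H]
    {π : G →* (H ≃ₗᵢ[ℂ] H)} (hπ : IsErgodicRep π) {v : H} (hv : ∀ g, π g v = v) : v = 0 := by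
  obtain ⟨m, hm, h0⟩ := hπ
  have hconst : coeff π v v = (inner ℂ v v : ℂ) • WAP.one G := by
    refine Subtype.ext (lp.ext (funext fun x => ?_))
    change inner ℂ v (π x v) = inner ℂ v v * 1
    rw [hv, mul_one]
  have h := h0 v v
  rw [hconst, map_smul, hm.map_one, smul_eq_mul, mul_one] at h
  exact inner_self_eq_zero.1 h

/-- On a `μ`-Liouville group, a vector fixed by the averaging operator `∑ μ(s) π(s)` of a unitary
representation is fixed by the whole group, because `x ↦ ⟨η, π(x⁻¹) v⟩` is bounded and
`μ`-harmonic. -/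
theorem IsLiouvilleGroup.fixed_of_average_fixed {G : Type*} [Group G]
    {H : Type*} [NormedAddCommGroup H] [InnerProductSpace ℂ H]
    (π : G →* (H ≃ₗᵢ[ℂ] H)) {μ : G →₀ ℝ} (hL : IsLiouvilleGroup μ) {v : H}
    (hv : ∑ s ∈ μ.support, (μ s : ℂ) • π s v = v) (g : G) : π g v = v := by
  refine ext_inner_left ℂ fun η => ?_
  obtain ⟨c, hc⟩ := hL
    (LInfty.ofBound (fun x => inner ℂ η (π x⁻¹ v)) (‖η‖ * ‖v‖) fun x => by
      simpa using norm_inner_le_norm (𝕜 := ℂ) η (π x⁻¹ v)) fun x => by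
    change ∑ s ∈ μ.support, (μ s : ℂ) * inner ℂ η (π (s⁻¹ * x)⁻¹ v) = inner ℂ η (π x⁻¹ v)
    -- The inverse in `π x⁻¹` matches the left translation in the Liouville condition: `(s⁻¹x)⁻¹ =
    -- x⁻¹s` puts `π s` directly on `v`, where the averaging identity applies.
    conv_rhs => rw [← hv, map_sum, inner_sum]
    refine Finset.sum_congr rfl fun s _ => ?_
    rw [map_smul, inner_smul_right, mul_inv_rev, inv_inv, map_mul,
      LinearIsometryEquiv.coe_mul, Function.comp_apply]
  -- Constancy is used at two points only: `g⁻¹` gives `⟨η, π(g)v⟩` and `1` gives `⟨η, v⟩`.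
  have hg : inner ℂ η (π g⁻¹⁻¹ v) = c := hc g⁻¹
  have h1 : inner ℂ η (π (1 : G)⁻¹ v) = c := hc 1
  rw [inv_inv] at hg
  rw [inv_one, map_one] at h1
  exact hg.trans h1.symm

/-- For central `z`, comparing `b(zg)` with `b(gz)`. -/
theorem Z1.sub_eq_of_mem_center {G : Type*} [Group G]
    {H : Type*} [NormedAddCommGroup H] [InnerProductSpace ℂ H]
    {π : G →* (H ≃ₗᵢ[ℂ] H)} (b : Z1 π) {z : G} (hz : z ∈ Subgroup.center G) (g : G) :
    π g (b.1 z) - b.1 z = π z (b.1 g) - b.1 g := by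
  have h := b.2 g z
  rw [Subgroup.mem_center_iff.1 hz g, b.2 z g] at h
  rw [sub_eq_sub_iff_add_eq_add, add_comm, ← h, add_comm]

/-- An isometric action that fixes the values of a cocycle fixes their closed linear span. -/
theorem mem_repKerOn_cocycleImage {G : Type*} [Group G]
    {H : Type*} [NormedAddCommGroup H] [InnerProductSpace ℂ H]
    {π : G →* (H ≃ₗᵢ[ℂ] H)} (b : Z1 π) {z : G} (hz : ∀ g, π z (b.1 g) = b.1 g) :
    z ∈ repKerOn π (cocycleImage b) := by
  intro v hv
  refine closure_minimal (s := (Submodule.span ℂ (Set.range b.1) : Set H))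
    (t := {v | π z v = v}) (fun w hw => ?_)
    (isClosed_eq (π z).continuous continuous_id) hv
  refine LinearMap.eqOn_span (f := (π z).toLinearEquiv.toLinearMap) (g := LinearMap.id) ?_ hw
  rintro _ ⟨g, rfl⟩
  exact hz g

theorem mainTheorem3 {G : Type*} [Group G] [Group.FG G]
    {H : Type*} [NormedAddCommGroup H] [InnerProductSpace ℂ H] [CompleteSpace H]
    (π : G →* (H ≃ₗᵢ[ℂ] H)) (hπ : IsErgodicRep π) (hH1 : Nontrivial (ReducedH1 π))
    (μ : G →₀ ℝ) (hμ : IsSymmProbability μ) (hL : IsLiouvilleGroup μ)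
    (b : Z1 π) (hb : IsHarmonicCocycle μ b) (hb0 : b ≠ 0) :
    Subgroup.center G ≤ cocycleKer b ⊓ repKerOn π (cocycleImage b) := by
  intro z hz
  have hcomm := Z1.sub_eq_of_mem_center b hz
  have hmass : ∑ s ∈ μ.support, (μ s : ℂ) = 1 := by exact_mod_cast hμ.total
  have hb' : ∑ s ∈ μ.support, (μ s : ℂ) • b.1 s = 0 := hb
  -- Each `π(s)b(z)` is `b(z)` plus a correction `π(z)b(s) - b(s)`. The corrections average to `0`
  -- by harmonicity, and total mass `1` returns `b(z)`.
  have havg : ∑ s ∈ μ.support, (μ s : ℂ) • π s (b.1 z) = b.1 z := by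
    have hπs : ∀ s, π s (b.1 z) = b.1 z + (π z (b.1 s) - b.1 s) := fun s => by
      rw [← hcomm s, add_sub_cancel]
    have hπz : ∑ s ∈ μ.support, (μ s : ℂ) • π z (b.1 s) = 0 := by
      simp_rw [← map_smul]
      rw [← map_sum, hb', map_zero]
    simp_rw [hπs, smul_add, smul_sub]
    rw [Finset.sum_add_distrib, Finset.sum_sub_distrib, ← Finset.sum_smul, hmass, hπz, hb',
      one_smul, sub_zero, add_zero]
  have hz0 : b.1 z = 0 := hπ.eq_zero_of_forall_fixed (hL.fixed_of_average_fixed π havg)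
  refine ⟨hz0, mem_repKerOn_cocycleImage b fun g => ?_⟩
  -- With `b(z) = 0` the left side of the commutation identity vanishes.
  have h := hcomm g
  rw [hz0, map_zero, sub_zero] at h
  exact sub_eq_zero.1 h.symm
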